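/- **Setting.** Let $V$ be a finite set of sensors at fixed positions $\mathbf p_i=(p_{x,i},p_{y,i},p_{z,i})\in\mathbb R^3$. Sensor $i$ receives information from the sensors in its neighbour set $\mathcal N_i\subseteq V\setminus\{i\}$, and the network $\mathcal G_W$ with links $(i,j)$, $j\in\mathcal N_i$, is strongly connected. Let $F$ be the NCV or the NCA transition matrix with sampling time $T>0$, $$F=\begin{pmatrix} I_3& TI_3\\ 0& I_3\end{pmatrix}\quad\text{or}\quad F=\begin{pmatrix} I_3& TI_3&\tfrac{T^2}{2}I_3\\ 0&I_3&TI_3\\ 0&0&I_3\end{pmatrix}.$$ Let $H_i$ be the constant output matrix of the modified linear TDOA model, with one row $\big((\mathbf p_j-\mathbf p_i)^\top,0,\dots,0\big)$ for each $j\in\mathcal N_i$, and let $D_H=\mathrm{blkdiag}(H_i^\top H_i)$. A fusion matrix of the network is a row-stochastic $W$ with $0<W_{ij}<1$ for $j\in\{i\}\cup\mathcal N_i$ and $W_{ij}=0$ otherwise. A pair $(A,C)$ with $A\in\mathbb R^{m\times m}$ is observable if the matrix with block rows $C,CA,\dots,CA^{m-1}$ has rank $m$. It is structurally (generically) observable if,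 when the nonzero entries of $A$ and $C$ are replaced by independent real parameters and the zero entries are kept, the resulting pair is observable for Lebesgue-almost every value of the parameters. **Theorem.** Assume that in each of the three coordinates not all sensors have the same position, that is, the sensors do not all lie in one plane orthogonal to a coordinate axis. 1. For every fusion matrix $W$ of the network, the pair $(W\otimes F,D_H)$ is structurally observable. 2. If, moreover, the sensors do not all lie in one plane, then the pair $(W\otimes F,D_H)$ itself is observable for almost every fusion matrix $W$ of the network (with respect to Lebesgue measure in the link weights $W_{ij}$, $j\in\mathcal N_i$, which determine $W$). -/

import Mathlib

open scoped Kronecker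
open MeasureTheory

noncomputable section

/-- The Kalman observability matrix `[C; C A; …; C A ^ (N - 1)]` of the pair `(A, C)`, where `N` is
the dimension of the state space. -/
def observabilityMatrix {ι κ : Type*} [Fintype ι] [DecidableEq ι]
    (A : Matrix ι ι ℝ) (C : Matrix κ ι ℝ) : Matrix (Fin (Fintype.card ι) × κ) ι ℝ :=
  Matrix.of fun r s => (C * A ^ (r.1 : ℕ)) r.2 s

/-- The pair `(A, C)` is observable: its observability matrix has full column rank. -/
def IsObservable {ι κ : Type*} [Fintype ι] [DecidableEq ι]
    (A : Matrix ι ι ℝ) (C : Matrix κ ι ℝ) : Prop :=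
  (observabilityMatrix A C).rank = Fintype.card ι

/-- The positions of the nonzero entries of a matrix: its structure. -/
abbrev NonzeroPos {κ ι : Type*} (A : Matrix κ ι ℝ) : Type _ :=
  {q : κ × ι // A q.1 q.2 ≠ 0}

/-- The matrix with the structure of `A` whose entries at the nonzero positions of `A` are reassigned
to the values `θ`, all the other entries staying zero. -/
def reassign {κ ι : Type*} (A : Matrix κ ι ℝ) (θ : NonzeroPos A → ℝ) : Matrix κ ι ℝ :=
  Matrix.of fun r s => if h : A r s ≠ 0 then θ ⟨(r, s), h⟩ else 0

/-- The pair `(A, C)` is structurally (generically) observable: Lebesgue almost every independent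
choice of numerical values for the nonzero entries of `A` and `C` gives an observable pair. -/
def IsGenericallyObservable {ι κ : Type*} [Fintype ι] [DecidableEq ι] [Fintype κ]
    (A : Matrix ι ι ℝ) (C : Matrix κ ι ℝ) : Prop :=
  ∀ᵐ θ : (NonzeroPos A ⊕ NonzeroPos C) → ℝ,
    IsObservable (reassign A fun q => θ (Sum.inl q)) (reassign C fun q => θ (Sum.inr q))

/-- The two target models: nearly constant velocity and nearly constant acceleration. -/
inductive TargetModel
  | ncv
  | nca

/-- The number of derivatives of the position (the position itself included) in the state. -/
def TargetModel.order : TargetModel → ℕ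
  | .ncv => 2
  | .nca => 3

/-- Index set of the target state: `(0, c)`, `(1, c)`, `(2, c)` index the position, velocity and
acceleration in the coordinate direction `c`. -/
abbrev TargetModel.State (M : TargetModel) : Type := Fin M.order × Fin 3

/-- The transition matrix of the target model for the sampling time `T`; the factor `1` is the
`3 × 3` identity matrix. -/
def TargetModel.transition : (M : TargetModel) → ℝ → Matrix M.State M.State ℝ
  | .ncv, T => !![1, T; 0, 1] ⊗ₖ (1 : Matrix (Fin 3) (Fin 3) ℝ)
  | .nca, T => !![1, T, T ^ 2 / 2; 0, 1, T; 0, 0, 1] ⊗ₖ (1 : Matrix (Fin 3) (Fin 3) ℝ)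

/-- The sensor network in which sensor `i` receives from the sensors in `N i` is strongly connected. -/
def StronglyConnected {V : Type*} (N : V → Finset V) : Prop :=
  ∀ i j : V, Relation.ReflTransGen (fun a b => b ∈ N a) i j

/-- `W` is a fusion (consensus) matrix of the network: row-stochastic, with weights in `(0, 1)` exactly
at the pairs `(i, j)` with `j ∈ {i} ∪ N i`. -/
structure IsFusionMatrix {V : Type*} [Fintype V] (N : V → Finset V) (W : Matrix V V ℝ) : Prop where
  mem_Ioo : ∀ i j, j = i ∨ j ∈ N i → W i j ∈ Set.Ioo (0 : ℝ) 1
  eq_zero : ∀ i j, ¬(j = i ∨ j ∈ N i) → W i j = 0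
  row_sum : ∀ i, ∑ j, W i j = 1

/-- The constant output matrix `H_i` of sensor `i`: one row `(p_j - p_i, 0, …, 0)` for each
neighbour `j` of `i`. -/
def outputMatrix {V : Type*} (N : V → Finset V) (p : V → EuclideanSpace ℝ (Fin 3))
    (M : TargetModel) (i : V) : Matrix {j // j ∈ N i} M.State ℝ :=
  Matrix.of fun j s => if (s.1 : ℕ) = 0 then p j s.2 - p i s.2 else 0

/-- The block-diagonal matrix `D_H = blkdiag(H_iᵀ H_i)`, indexed by pairs (sensor, state). -/
def outputGram {V : Type*} [DecidableEq V] (N : V → Finset V) (p : V → EuclideanSpace ℝ (Fin 3))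
    (M : TargetModel) : Matrix (V × M.State) (V × M.State) ℝ :=
  (Matrix.blockDiagonal fun i => (outputMatrix N p M i).transpose * outputMatrix N p M i).submatrix
    Prod.swap Prod.swap

end

/-!
For each model the transition matrix is `G ⊗ 1`, where the single-coordinate matrix `G` is unit upper
triangular with nonzero superdiagonal, so `W ⊗ F = W ⊗ G ⊗ 1`. Both assertions follow from one fact
about `W ⊗ G`: for almost all link weights, the row-stochastic `W` they determine makes `W ⊗ G`
observable from the position component of every single node (`StronglyConnected.ae_affineWeights`).

* Each link `(i, j)` measures the component of the position along `p j - p i`, so, by this fact, the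
  outputs determine the component of the whole state along every link. If the sensors span the space,
  the links do too, and the state is determined (`isObservable_outputGram`).
* If the sensors only differ in each coordinate, then for each coordinate `c` some diagonal entry of
  `D_H` that measures the coordinate `c` is nonzero. Keeping the diagonal of `D_H` and a good `W` gives
  one observable pair with the given structure (`isObservable_of_diagonal`).

Observability fails exactly where a determinant that is polynomial in the parameters vanishes, and the
zero set of a nonzero polynomial is Lebesgue null (`MvPolynomial.ae_eval_ne_zero`), so one observable
choice of the parameters suffices (`ae_isObservable_of_exists`).

When loop weights are free, a good choice for observation from node `i` is a spanning tree rooted at `i`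
with distinct nonzero loop weights: it has no generalized eigenvectors, and each eigenvector is nonzero
at the root, because it is supported on the ancestors of one node; the eigenvectors of its product with
`G` reduce to these (`ParentTree.observesFrom`). Tree matrices do not have row sums one, and trees with
row sums one need not work: all leaves then have loop weight one. The row-sum constraint is instead met
by normalization. Some weights `B`, positive on all loops and links, are good for all nodes
simultaneously, and a positive eigenvector `B u = ρ u` exists by the Perron–Frobenius theorem, proved
here by the Collatz–Wielandt argument (`StronglyConnected.exists_perron`). Then `B i j * u j / (ρ * u i)`
has row sums one, and it inherits the observability of `B` since it is similar to `ρ⁻¹ B` by a diagonal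
matrix (`ObservesFrom.of_scaling`).
-/

open Matrix

/-! ### Zero sets of polynomials -/

/-- The zero set of a nonzero real polynomial in finitely many variables is Lebesgue null; case of
the variables indexed by `Fin n`, by induction on `n` and Fubini. -/
theorem MvPolynomial.ae_eval_ne_zero_fin (n : ℕ) (p : MvPolynomial (Fin n) ℝ) (hp : p ≠ 0) :
    ∀ᵐ x : Fin n → ℝ, MvPolynomial.eval x p ≠ 0 := by
  induction n with
  | zero =>
    refine Filter.Eventually.of_forall fun x h => hp ?_
    apply MvPolynomial.funext
    intro y
    rw [Subsingleton.elim y x, h, map_zero]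
  | succ n ih =>
    set q := MvPolynomial.finSuccEquiv ℝ n p with hq
    have hq0 : q ≠ 0 := by simpa [hq] using hp
    have hlead := ih q.leadingCoeff (Polynomial.leadingCoeff_ne_zero.2 hq0)
    have hpres := (volume_preserving_piFinSuccAbove (fun _ : Fin (n + 1) => ℝ) 0)
    have hmeas : MeasurableSet {x : Fin (n + 1) → ℝ | MvPolynomial.eval x p ≠ 0} :=
      (isOpen_ne_fun (MvPolynomial.continuous_eval p) continuous_const).measurableSet
    have key : ∀ᵐ z : ℝ × (Fin n → ℝ),
        MvPolynomial.eval ((MeasurableEquiv.piFinSuccAbove (fun _ => ℝ) 0).symm z) p ≠ 0 := by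
      rw [Measure.volume_eq_prod]
      refine (Measure.ae_prod_iff_ae_ae ?_).2 ?_
      · exact (MeasurableEquiv.measurable _) hmeas
      · rw [Measure.ae_ae_comm]
        · filter_upwards [hlead] with s hs
          have hmap : q.map (MvPolynomial.eval s) ≠ 0 := by
            intro h0
            apply hs
            have := congrArg (fun r : Polynomial ℝ => r.coeff q.natDegree) h0
            simpa [Polynomial.coeff_map] using this
          have hfin : {y : ℝ | (q.map (MvPolynomial.eval s)).IsRoot y}.Finite :=
            Polynomial.finite_setOfPred_isRoot hmap
          have hnull : ∀ᵐ y : ℝ, ¬ (q.map (MvPolynomial.eval s)).IsRoot y :=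
            compl_mem_ae_iff.2 (hfin.measure_zero _)
          filter_upwards [hnull] with y hy h0
          apply hy
          rw [Polynomial.IsRoot, ← MvPolynomial.eval_eq_eval_mv_eval']
          simpa [Fin.insertNthEquiv, Fin.insertNth_zero] using h0
        · exact (MeasurableEquiv.measurable _) hmeas
    filter_upwards [hpres.quasiMeasurePreserving.ae key] with x hx
    rwa [MeasurableEquiv.symm_apply_apply] at hx

/-- The zero set of a nonzero real polynomial in finitely many variables is Lebesgue null. -/
theorem MvPolynomial.ae_eval_ne_zero {σ : Type*} [Fintype σ] (p : MvPolynomial σ ℝ) (hp : p ≠ 0) :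
    ∀ᵐ x : σ → ℝ, MvPolynomial.eval x p ≠ 0 := by
  let e := Fintype.equivFin σ
  have h0 : MvPolynomial.rename e p ≠ 0 := fun h =>
    hp (MvPolynomial.rename_injective e e.injective (by rw [h, map_zero]))
  have h1 := MvPolynomial.ae_eval_ne_zero_fin _ _ h0
  have hpres := volume_measurePreserving_piCongrLeft (fun _ : Fin (Fintype.card σ) => ℝ) e
  have h2 := hpres.quasiMeasurePreserving.ae h1
  filter_upwards [h2] with x hx
  rw [MvPolynomial.eval_rename] at hx
  convert hx using 3
  funext i
  simp [MeasurableEquiv.piCongrLeft, Equiv.piCongrLeft_apply_apply]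

/-! ### Observability -/

section Observability

variable {ι κ : Type*} [Fintype ι] [DecidableEq ι]

theorem observabilityMatrix_mulVec_eq_zero (A : Matrix ι ι ℝ) (C : Matrix κ ι ℝ) (x : ι → ℝ) :
    observabilityMatrix A C *ᵥ x = 0 ↔ ∀ n < Fintype.card ι, (C * A ^ n) *ᵥ x = 0 := by
  constructor
  · intro h n hn
    funext k
    exact congrFun h (⟨n, hn⟩, k)
  · intro h
    funext ⟨n, k⟩
    exact congrFun (h n n.2) k

/-- By the Cayley–Hamilton theorem, outputs that vanish up to the dimension of the state space vanish
forever. -/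
theorem mul_pow_mulVec_eq_zero (A : Matrix ι ι ℝ) (C : Matrix κ ι ℝ) (x : ι → ℝ)
    (h : ∀ n < Fintype.card ι, (C * A ^ n) *ᵥ x = 0) (n : ℕ) : (C * A ^ n) *ᵥ x = 0 := by
  rcases isEmpty_or_nonempty ι with hι | hι
  · simp [Subsingleton.elim x 0]
  rw [Matrix.pow_eq_aeval_mod_charpoly, Polynomial.aeval_eq_sum_range, Matrix.mul_sum,
    Matrix.sum_mulVec]
  refine Finset.sum_eq_zero fun k hk => ?_
  rw [Matrix.mul_smul, Matrix.smul_mulVec, h k, smul_zero]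
  have hdeg : (Polynomial.X ^ n %ₘ A.charpoly).natDegree < A.charpoly.natDegree := by
    refine Polynomial.natDegree_modByMonic_lt _ A.charpoly_monic fun h1 => ?_
    have := A.charpoly_natDegree_eq_dim
    rw [h1, Polynomial.natDegree_one] at this
    exact Fintype.card_ne_zero this.symm
  rw [A.charpoly_natDegree_eq_dim] at hdeg
  have := Finset.mem_range.1 hk
  omega

theorem isObservable_iff_ker (A : Matrix ι ι ℝ) (C : Matrix κ ι ℝ) :
    IsObservable A C ↔ ∀ x, observabilityMatrix A C *ᵥ x = 0 → x = 0 := by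
  have h := LinearMap.finrank_range_add_finrank_ker (observabilityMatrix A C).mulVecLin
  rw [Module.finrank_fintype_fun_eq_card] at h
  change (observabilityMatrix A C).rank + _ = _ at h
  have h' : IsObservable A C ↔
      Module.finrank ℝ (LinearMap.ker (observabilityMatrix A C).mulVecLin) = 0 := by
    unfold IsObservable
    omega
  rw [h', Submodule.finrank_eq_zero, LinearMap.ker_eq_bot']
  rfl

/-- A pair is observable iff the only state with identically vanishing outputs is zero. -/
theorem isObservable_iff (A : Matrix ι ι ℝ) (C : Matrix κ ι ℝ) :
    IsObservable A C ↔ ∀ x, (∀ n, C *ᵥ (A ^ n *ᵥ x) = 0) → x = 0 := by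
  rw [isObservable_iff_ker]
  refine forall_congr' fun x => imp_congr_left ?_
  rw [observabilityMatrix_mulVec_eq_zero]
  simp only [Matrix.mulVec_mulVec]
  exact ⟨fun h n => mul_pow_mulVec_eq_zero A C x h n, fun h n _ => h n⟩

theorem isObservable_iff_det [Fintype κ] (A : Matrix ι ι ℝ) (C : Matrix κ ι ℝ) :
    IsObservable A C ↔ ((observabilityMatrix A C)ᵀ * observabilityMatrix A C).det ≠ 0 := by
  rw [isObservable_iff_ker, ← not_iff_not, not_not, ← Matrix.exists_mulVec_eq_zero_iff]
  push Not
  refine exists_congr fun x => ?_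
  have h := Matrix.ker_mulVecLin_transpose_mul_self (observabilityMatrix A C)
  have hx := SetLike.ext_iff.1 h x
  simp only [LinearMap.mem_ker, Matrix.mulVecLin_apply] at hx
  rw [hx, and_comm]

/-- If the entries of a pair depend polynomially on finitely many real parameters, and the pair is
observable for one value of the parameters, then it is observable for almost every value. -/
theorem ae_isObservable_of_exists [Fintype κ] {σ : Type*} [Fintype σ]
    (A : (σ → ℝ) → Matrix ι ι ℝ) (C : (σ → ℝ) → Matrix κ ι ℝ)
    (hA : ∀ i j, ∃ P : MvPolynomial σ ℝ, ∀ θ, A θ i j = MvPolynomial.eval θ P)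
    (hC : ∀ i j, ∃ P : MvPolynomial σ ℝ, ∀ θ, C θ i j = MvPolynomial.eval θ P)
    (hex : ∃ θ, IsObservable (A θ) (C θ)) : ∀ᵐ θ : σ → ℝ, IsObservable (A θ) (C θ) := by
  choose PA hPA using hA
  choose PC hPC using hC
  let O : Matrix (Fin (Fintype.card ι) × κ) ι (MvPolynomial σ ℝ) :=
    Matrix.of fun r s => (Matrix.of PC * (Matrix.of PA) ^ (r.1 : ℕ)) r.2 s
  have hO : ∀ θ, O.map (MvPolynomial.eval θ) = observabilityMatrix (A θ) (C θ) := by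
    intro θ
    have e1 : (Matrix.of PA).map (MvPolynomial.eval θ) = A θ := by
      ext i j; simp [hPA]
    have e2 : (Matrix.of PC).map (MvPolynomial.eval θ) = C θ := by
      ext i j; simp [hPC]
    ext r s
    have e3 : (Matrix.of PC * (Matrix.of PA) ^ (r.1 : ℕ)).map (MvPolynomial.eval θ)
        = C θ * A θ ^ (r.1 : ℕ) := by
      rw [Matrix.map_mul, Matrix.map_pow, e1, e2]
    exact congrFun (congrFun e3 r.2) s
  have hdet : ∀ θ, MvPolynomial.eval θ (Oᵀ * O).det
      = ((observabilityMatrix (A θ) (C θ))ᵀ * observabilityMatrix (A θ) (C θ)).det := by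
    intro θ
    rw [RingHom.map_det, RingHom.mapMatrix_apply, Matrix.map_mul, ← hO, Matrix.transpose_map]
  obtain ⟨θ₀, h₀⟩ := hex
  have hne : (Oᵀ * O).det ≠ 0 := by
    intro h
    rw [isObservable_iff_det, ← hdet, h, map_zero] at h₀
    exact h₀ rfl
  filter_upwards [MvPolynomial.ae_eval_ne_zero _ hne] with θ hθ
  rwa [isObservable_iff_det, ← hdet]

end Observability

/-! ### Eigenvector test -/

/-- One half of the Popov–Belevitch–Hautus test: a real pair is observable if no complex eigenvector of
the state matrix is annihilated by the output matrix. -/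
theorem isObservable_of_eigenvector {ι κ : Type*} [Fintype ι] [DecidableEq ι]
    (A : Matrix ι ι ℝ) (C : Matrix κ ι ℝ)
    (h : ∀ (μ : ℂ) (v : ι → ℂ), A.map Complex.ofRealHom *ᵥ v = μ • v →
      C.map Complex.ofRealHom *ᵥ v = 0 → v = 0) : IsObservable A C := by
  rw [isObservable_iff]
  intro x hx
  set A' := A.map Complex.ofRealHom with hA'
  set C' := C.map Complex.ofRealHom with hC'
  -- the unobservable subspace of the complexified pair
  let U : Submodule ℂ (ι → ℂ) :=
    { carrier := {v | ∀ n, C' *ᵥ (A' ^ n *ᵥ v) = 0}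
      add_mem' := fun {a b} ha hb n => by
        rw [Matrix.mulVec_add, Matrix.mulVec_add, ha n, hb n, add_zero]
      zero_mem' := fun n => by simp
      smul_mem' := fun c a ha n => by
        rw [Matrix.mulVec_smul, Matrix.mulVec_smul, ha n, smul_zero] }
  have hU : ∀ v ∈ U, A'.mulVecLin v ∈ U := fun v hv n => by
    rw [Matrix.mulVecLin_apply, Matrix.mulVec_mulVec _ (A' ^ n) A', ← pow_succ]
    exact hv (n + 1)
  have hbot : U = ⊥ := by
    by_contra hne
    have : Nontrivial U := Submodule.nontrivial_iff_ne_bot.2 hne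
    obtain ⟨μ, hμ⟩ := Module.End.exists_eigenvalue (A'.mulVecLin.restrict hU)
    obtain ⟨v, hv⟩ := hμ.exists_hasEigenvector
    have h1 := congrArg Subtype.val hv.apply_eq_smul
    have h2 : C' *ᵥ v.1 = 0 := by simpa using v.2 0
    exact hv.2 (Subtype.ext (h μ v.1 h1 h2))
  have hxU : Complex.ofRealHom ∘ x ∈ U := fun n => by
    have := hx n
    rw [Matrix.mulVec_mulVec] at this ⊢
    rw [hC', hA', ← Matrix.map_pow, ← Matrix.map_mul]
    funext k
    have e := RingHom.map_mulVec Complex.ofRealHom (C * A ^ n) x k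
    rw [this] at e
    rw [← e]
    simp
  rw [hbot, Submodule.mem_bot] at hxU
  funext s
  have := congrFun hxU s
  simpa using this

/-! ### Observation of a Kronecker product from one node -/

/-- The matrix `B ⊗ₖ G`, with `B` indexed by the sensors, is observable from the single output
`(i, z)`: the component `z` of the state of the sensor `i`. -/
def ObservesFrom {V R : Type*} [Fintype V] [DecidableEq V] [Fintype R] [DecidableEq R]
    (B : Matrix V V ℝ) (G : Matrix R R ℝ) (i : V) (z : R) : Prop :=
  IsObservable (B ⊗ₖ G) (Matrix.replicateRow Unit (Pi.single (i, z) 1))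

theorem kronecker_mulVec_apply {V R S : Type*} [Fintype V] [Fintype R]
    [CommSemiring S] (B : Matrix V V S) (G : Matrix R R S)
    (v : V × R → S) (a : V) (k : R) :
    ((B ⊗ₖ G) *ᵥ v) (a, k) = ∑ l, G k l * (B *ᵥ fun c => v (c, l)) a := by
  simp only [Matrix.mulVec, dotProduct, Matrix.kroneckerMap_apply, Fintype.sum_prod_type,
    Finset.mul_sum]
  rw [Finset.sum_comm]
  refine Finset.sum_congr rfl fun l _ => Finset.sum_congr rfl fun c _ => ?_
  ring

section Kron

variable {V R : Type*} [Fintype V] [DecidableEq V] [Fintype R] [DecidableEq R]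

theorem observesFrom_iff (B : Matrix V V ℝ) (G : Matrix R R ℝ) (i : V) (z : R) :
    ObservesFrom B G i z ↔ ∀ x, (∀ n, ((B ⊗ₖ G) ^ n *ᵥ x) (i, z) = 0) → x = 0 := by
  unfold ObservesFrom
  rw [isObservable_iff]
  refine forall_congr' fun x => imp_congr_left (forall_congr' fun n => ?_)
  rw [funext_iff]
  simp [Matrix.mulVec, Matrix.replicateRow]

/-- If `G` is a single Jordan block up to a change of basis (unit upper triangular with nonzero
superdiagonal) and `B` is invertible, semisimple and observable from node `i`, then every eigenvector of
`B ⊗ₖ G` is supported in the slice `z = 0` and is an eigenvector of `B` there, so `B ⊗ₖ G` is observable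
from `(i, z)`. -/
theorem observesFrom_of_semisimple {r : ℕ} (B : Matrix V V ℝ) (G : Matrix (Fin r) (Fin r) ℝ)
    (i : V) (z : Fin r) (hz : (z : ℕ) = 0)
    (hG1 : ∀ k, G k k = 1) (hG0 : ∀ k l, l < k → G k l = 0)
    (hGs : ∀ k l : Fin r, (l : ℕ) = k + 1 → G k l ≠ 0)
    (hinv : ∀ v : V → ℂ, B.map Complex.ofRealHom *ᵥ v = 0 → v = 0)
    (hsemi : ∀ (μ : ℂ) (v w : V → ℂ), B.map Complex.ofRealHom *ᵥ v = μ • v →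
      B.map Complex.ofRealHom *ᵥ w = μ • w + v → v = 0)
    (hobs : ∀ (μ : ℂ) (v : V → ℂ), B.map Complex.ofRealHom *ᵥ v = μ • v → v i = 0 → v = 0) :
    ObservesFrom B G i z := by
  refine isObservable_of_eigenvector _ _ fun μ v hv hCv => ?_
  set B' := B.map Complex.ofRealHom with hB'
  have hmap : (B ⊗ₖ G).map Complex.ofRealHom = B' ⊗ₖ G.map Complex.ofRealHom := by
    ext a b
    simp [hB', Matrix.kroneckerMap_apply]
  rw [hmap] at hv
  have hiz : v (i, z) = 0 := by
    have := congrFun hCv ()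
    simpa [Matrix.mulVec, dotProduct, Matrix.replicateRow, Pi.single_apply] using this
  let s : Fin r → V → ℂ := fun l c => v (c, l)
  have hslice : ∀ k, ∑ l, (G k l : ℂ) • (B' *ᵥ s l) = μ • s k := by
    intro k
    funext a
    have := congrFun hv (a, k)
    rw [kronecker_mulVec_apply] at this
    simpa [s] using this
  suffices hs : ∀ k, s k = 0 by
    funext ⟨c, l⟩
    exact congrFun (hs l) c
  by_contra hne
  push Not at hne
  obtain ⟨k, hk, hmax⟩ : ∃ k, s k ≠ 0 ∧ ∀ l, k < l → s l = 0 := by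
    classical
    obtain ⟨k, hk, hm⟩ := (Finset.univ.filter fun k => s k ≠ 0).exists_max_image id
      (by obtain ⟨k, hk⟩ := hne; exact ⟨k, by simpa using hk⟩)
    refine ⟨k, by simpa using hk, fun l hl => ?_⟩
    by_contra h
    exact absurd (hm l (by simpa using h)) (not_le.2 hl)
  have heig : B' *ᵥ s k = μ • s k := by
    rw [← hslice k, Finset.sum_eq_single k, hG1]
    · simp
    · intro l _ hl
      rcases lt_or_gt_of_ne hl with h | h
      · simp [hG0 k l h]
      · simp [hmax l h]
    · simp
  rcases Nat.eq_zero_or_pos (k : ℕ) with h0 | hpos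
  · have : k = z := Fin.ext (by omega)
    exact hk (hobs μ _ heig (by rw [this]; exact hiz))
  · have hμ : μ ≠ 0 := by
      rintro rfl
      exact hk (hinv _ (by rw [heig, zero_smul]))
    let j : Fin r := ⟨k - 1, by omega⟩
    have hjk : (k : ℕ) = j + 1 := by simp only [j]; omega
    have hjlt : j < k := Fin.lt_def.2 (by omega)
    have hg : (G j k : ℂ) ≠ 0 := by exact_mod_cast hGs j k hjk
    have hj := hslice j
    rw [Finset.sum_eq_add_of_mem j k (Finset.mem_univ _) (Finset.mem_univ _) hjlt.ne, hG1, heig] at hj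
    · -- the slice with index one less than the top one is a generalized eigenvector
      refine hk (hsemi μ _ (-((G j k : ℂ) * μ)⁻¹ • s j) heig ?_)
      have e : B' *ᵥ s j = μ • s j - ((G j k : ℂ) * μ) • s k := by
        rw [← hj, smul_smul]; simp
      rw [Matrix.mulVec_smul, e]
      funext a
      simp only [Pi.smul_apply, Pi.sub_apply, Pi.add_apply, smul_eq_mul]
      field_simp
      ring
    · intro l _ hl
      rcases lt_or_ge l j with h | h
      · simp [hG0 j l h]
      · have : k < l := Fin.lt_def.2 (by
          have := Fin.le_def.1 h
          have h1 : (l : ℕ) ≠ j := fun h => hl.1 (Fin.ext h)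
          have h2 : (l : ℕ) ≠ k := fun h => hl.2 (Fin.ext h)
          omega)
        simp [hmax l this]

end Kron

/-! ### Weighted rooted trees -/

/-- A rooted tree on `V`, given by its parent map and the depth of its nodes. -/
structure ParentTree (V : Type*) where
  /-- the root -/
  root : V
  /-- the parent of a node; the root is its own parent -/
  parent : V → V
  /-- the distance of a node to the root -/
  depth : V → ℕ
  parent_root : parent root = root
  depth_root : depth root = 0
  depth_eq : ∀ j, j ≠ root → depth j = depth (parent j) + 1

namespace ParentTree

variable {V : Type*} (t : ParentTree V) {S : Type*} [Field S]

theorem depth_child {a c : V} (h : c ≠ t.root ∧ t.parent c = a) : t.depth c = t.depth a + 1 := by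
  rw [t.depth_eq c h.1, h.2]

theorem depth_iterate_parent (a : V) (k : ℕ) : t.depth (t.parent^[k] a) = t.depth a - k := by
  induction k with
  | zero => rfl
  | succ k ih =>
    rw [Function.iterate_succ_apply']
    by_cases h : t.parent^[k] a = t.root
    · rw [h] at ih ⊢
      rw [t.parent_root, t.depth_root] at *
      omega
    · have := t.depth_eq _ h
      omega

section Matrix

variable [DecidableEq V]

/-- The matrix of the tree with weight `d a` on the loop at `a` and weight `1` on each edge, directed
from the parent to the child: row `a` collects the values at `a` and at its children. -/
def matrix (d : V → S) : Matrix V V S :=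
  Matrix.diagonal d + Matrix.of fun a c => if c ≠ t.root ∧ t.parent c = a then 1 else 0

theorem matrix_map (d : V → ℝ) :
    (t.matrix d).map Complex.ofRealHom = t.matrix fun a => (d a : ℂ) := by
  ext a c
  simp only [matrix, Matrix.map_apply, Matrix.add_apply, Matrix.of_apply, map_add,
    Matrix.diagonal_apply]
  split_ifs <;> simp

end Matrix

variable [Fintype V]

theorem induction_children {P : V → Prop}
    (h : ∀ b, (∀ c, c ≠ t.root ∧ t.parent c = b → P c) → P b) (b : V) : P b := by
  obtain ⟨K, hK⟩ : ∃ K, ∀ b, t.depth b ≤ K :=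
    ⟨Finset.univ.sup t.depth, fun b => Finset.le_sup (Finset.mem_univ b)⟩
  induction hn : K - t.depth b using Nat.strong_induction_on generalizing b with
  | _ n ih =>
    refine h b fun c hc => ih (K - t.depth c) ?_ c rfl
    have := t.depth_child hc
    have := hK c
    omega

theorem exists_deepest {v : V → S} (hv : v ≠ 0) :
    ∃ a, v a ≠ 0 ∧ ∀ b, t.depth a < t.depth b → v b = 0 := by
  classical
  obtain ⟨b, hb⟩ := Function.ne_iff.1 hv
  obtain ⟨a, ha, hm⟩ := (Finset.univ.filter fun a => v a ≠ 0).exists_max_image t.depth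
    ⟨b, by simpa using hb⟩
  refine ⟨a, by simpa using ha, fun b hb => ?_⟩
  by_contra h
  exact absurd (hm b (by simpa using h)) (not_le.2 hb)

variable [DecidableEq V]

theorem matrix_mulVec (d : V → S) (v : V → S) (a : V) :
    (t.matrix d *ᵥ v) a = d a * v a + ∑ c with c ≠ t.root ∧ t.parent c = a, v c := by
  rw [matrix, Matrix.add_mulVec, Pi.add_apply, Matrix.mulVec_diagonal, Finset.sum_filter]
  simp [Matrix.mulVec, dotProduct]

theorem sum_children_eq_zero {v : V → S} {a : V} (h : ∀ b, t.depth a < t.depth b → v b = 0) :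
    ∑ c with c ≠ t.root ∧ t.parent c = a, v c = 0 := by
  refine Finset.sum_eq_zero fun c hc => h c ?_
  rw [t.depth_child (Finset.mem_filter.1 hc).2]
  exact Nat.lt_succ_self _

/-- The eigenvalue of an eigenvector is the loop weight at any deepest node of its support. -/
theorem eigenvalue_eq (d : V → S) {μ : S} {v : V → S} (hv : t.matrix d *ᵥ v = μ • v) {a : V}
    (ha : v a ≠ 0) (hdeep : ∀ b, t.depth a < t.depth b → v b = 0) : μ = d a := by
  have := congrFun hv a
  rw [t.matrix_mulVec, t.sum_children_eq_zero hdeep, add_zero, Pi.smul_apply, smul_eq_mul] at this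
  exact (mul_right_cancel₀ ha this).symm

theorem eq_zero_of_matrix_mulVec_eq_zero (d : V → S) (hd : ∀ a, d a ≠ 0) {v : V → S}
    (hv : t.matrix d *ᵥ v = 0) : v = 0 := by
  by_contra hne
  obtain ⟨a, ha, hdeep⟩ := t.exists_deepest hne
  exact hd a (t.eigenvalue_eq d (μ := 0) (by rw [hv, zero_smul]) ha hdeep).symm

/-- With distinct loop weights, the matrix of a tree has no proper generalized eigenvectors. -/
theorem eq_zero_of_generalized_eigenvector (d : V → S) (hd : Function.Injective d) {μ : S}
    {v w : V → S} (hv : t.matrix d *ᵥ v = μ • v) (hw : t.matrix d *ᵥ w = μ • w + v) : v = 0 := by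
  by_contra hne
  obtain ⟨a, ha, hdeep⟩ := t.exists_deepest hne
  have hμ := t.eigenvalue_eq d hv ha hdeep
  have hwdeep : ∀ b, t.depth a < t.depth b → w b = 0 := by
    intro b
    induction b using t.induction_children with
    | h b ih =>
      intro hb
      have h1 := congrFun hw b
      rw [t.matrix_mulVec, Finset.sum_eq_zero, Pi.add_apply, hdeep b hb, Pi.smul_apply, smul_eq_mul,
        add_zero, add_zero] at h1
      · by_contra hwb
        have : b = a := hd ((mul_right_cancel₀ hwb h1).trans hμ)
        rw [this] at hb
        exact lt_irrefl _ hb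
      · intro c hc
        have hc' := (Finset.mem_filter.1 hc).2
        refine ih c hc' ?_
        rw [t.depth_child hc']
        omega
  have h1 := congrFun hw a
  rw [t.matrix_mulVec, t.sum_children_eq_zero hwdeep, Pi.add_apply, Pi.smul_apply, smul_eq_mul,
    hμ, add_zero] at h1
  exact ha (by simpa using h1)

/-- With distinct loop weights, an eigenvector lives on the ancestors of one node `a` (its deepest
one) and is nonzero at all of them, up to the root. -/
theorem eq_zero_of_eigenvector_root (d : V → S) (hd : Function.Injective d) {μ : S}
    {v : V → S} (hv : t.matrix d *ᵥ v = μ • v) (hroot : v t.root = 0) : v = 0 := by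
  by_contra hne
  obtain ⟨a, ha, hdeep⟩ := t.exists_deepest hne
  have hμ := t.eigenvalue_eq d hv ha hdeep
  have hanc : ∀ b, v b ≠ 0 → ∃ k, t.parent^[k] a = b := by
    intro b
    induction b using t.induction_children with
    | h b ih =>
      intro hb
      by_cases hba : b = a
      · exact ⟨0, hba.symm⟩
      have h1 := congrFun hv b
      rw [t.matrix_mulVec, Pi.smul_apply, smul_eq_mul] at h1
      have h2 : ∑ c with c ≠ t.root ∧ t.parent c = b, v c ≠ 0 := by
        intro h0
        rw [h0, add_zero] at h1
        exact hba (hd ((mul_right_cancel₀ hb h1).trans hμ))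
      obtain ⟨c, hc, hvc⟩ := Finset.exists_ne_zero_of_sum_ne_zero h2
      have hc' := (Finset.mem_filter.1 hc).2
      obtain ⟨k, hk⟩ := ih c hc' hvc
      exact ⟨k + 1, by rw [Function.iterate_succ_apply', hk, hc'.2]⟩
  classical
  -- a node of the support of least depth: its parent sees no other child of the support
  obtain ⟨b, hb, hmin⟩ := (Finset.univ.filter fun b => v b ≠ 0).exists_min_image t.depth
    ⟨a, by simpa using ha⟩
  have hb' : v b ≠ 0 := by simpa using hb
  have hbr : b ≠ t.root := fun h => hb' (h ▸ hroot)
  have hdb := t.depth_eq b hbr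
  have hp : v (t.parent b) = 0 := by
    by_contra h
    have := hmin (t.parent b) (by simpa using h)
    omega
  have h1 := congrFun hv (t.parent b)
  rw [t.matrix_mulVec, Pi.smul_apply, hp, mul_zero, smul_zero, zero_add,
    Finset.sum_eq_single b] at h1
  · exact hb' h1
  · intro c hc hcb
    by_contra hvc
    obtain ⟨k, hk⟩ := hanc b hb'
    obtain ⟨l, hl⟩ := hanc c hvc
    have hdc := t.depth_child (Finset.mem_filter.1 hc).2
    have e1 := t.depth_iterate_parent a k
    have e2 := t.depth_iterate_parent a l
    rw [hk] at e1
    rw [hl] at e2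
    have : k = l := by omega
    exact hcb (by rw [← hl, ← hk, this])
  · intro h
    exact absurd (Finset.mem_filter.2 ⟨Finset.mem_univ _, hbr, rfl⟩) h

theorem observesFrom {r : ℕ} (G : Matrix (Fin r) (Fin r) ℝ) (z : Fin r) (hz : (z : ℕ) = 0)
    (hG1 : ∀ k, G k k = 1) (hG0 : ∀ k l, l < k → G k l = 0)
    (hGs : ∀ k l : Fin r, (l : ℕ) = k + 1 → G k l ≠ 0)
    (d : V → ℝ) (hd : Function.Injective d) (hd0 : ∀ a, d a ≠ 0) :
    ObservesFrom (t.matrix d) G t.root z := by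
  have hdc : Function.Injective fun a => (d a : ℂ) := Complex.ofReal_injective.comp hd
  refine observesFrom_of_semisimple _ G t.root z hz hG1 hG0 hGs ?_ ?_ ?_ <;> rw [t.matrix_map]
  · exact fun v => t.eq_zero_of_matrix_mulVec_eq_zero _ fun a => by exact_mod_cast hd0 a
  · exact fun μ v w => t.eq_zero_of_generalized_eigenvector _ hdc
  · exact fun μ v => t.eq_zero_of_eigenvector_root _ hdc

end ParentTree

/-- Breadth-first search in a strongly connected network: a spanning tree from any root, each node of
which receives from its children. -/
theorem StronglyConnected.exists_parentTree {V : Type*} {N : V → Finset V}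
    (h : StronglyConnected N) (i : V) :
    ∃ t : ParentTree V, t.root = i ∧ ∀ j, j ≠ i → j ∈ N (t.parent j) := by
  classical
  let reach : ℕ → Set V := fun n =>
    Nat.rec (motive := fun _ => Set V) {i} (fun _ s => {j | ∃ a ∈ s, j ∈ N a}) n
  have hex : ∀ j, ∃ n, j ∈ reach n := by
    intro j
    induction h i j with
    | refl => exact ⟨0, rfl⟩
    | tail _ hbc ih =>
      obtain ⟨n, hn⟩ := ih
      exact ⟨n + 1, _, hn, hbc⟩
  let depth : V → ℕ := fun j => Nat.find (hex j)
  have hroot : depth i = 0 := (Nat.find_eq_zero (hex i)).2 rfl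
  have hpar : ∀ j, j ≠ i → ∃ a, j ∈ N a ∧ depth j = depth a + 1 := by
    intro j hj
    have hspec : j ∈ reach (depth j) := Nat.find_spec (hex j)
    rcases hn : depth j with _ | n
    · rw [hn] at hspec
      exact absurd hspec hj
    · rw [hn] at hspec
      obtain ⟨a, ha, hja⟩ := hspec
      refine ⟨a, hja, ?_⟩
      have h1 : depth a ≤ n := Nat.find_le ha
      have h2 : depth j ≤ depth a + 1 := Nat.find_le ⟨a, Nat.find_spec (hex a), hja⟩
      omega
  choose! par hpar1 hpar2 using hpar
  refine ⟨⟨i, Function.update par i i, depth, by simp, hroot, fun j hj => ?_⟩, rfl, fun j hj => ?_⟩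
  · rw [Function.update_of_ne hj]
    exact hpar2 j hj
  · simp only [Function.update_of_ne hj]
    exact hpar1 j hj

/-! ### Perron vectors -/

/-- Collatz–Wielandt: if some polynomial in the nonnegative matrix `B` (here any matrix `P` commuting
with it) is entrywise positive, then `B` has a positive eigenvector. It is found by maximizing the `r`
with `r • x ≤ B x` over the standard simplex: if equality failed at the maximum, applying `P` would make
the inequality strict everywhere. -/
theorem exists_pos_eigenvector_of_commute {V : Type*} [Fintype V] [DecidableEq V] [Nonempty V]
    (B P : Matrix V V ℝ) (hB : ∀ i j, 0 ≤ B i j) (hP : ∀ i j, 0 < P i j) (hcomm : P * B = B * P) :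
    ∃ (r : ℝ) (u : V → ℝ), (∀ i, 0 < u i) ∧ B *ᵥ u = r • u := by
  have hPpos : ∀ y : V → ℝ, (∀ i, 0 ≤ y i) → y ≠ 0 → ∀ i, 0 < (P *ᵥ y) i := by
    intro y hy hne i
    obtain ⟨j, hj⟩ := Function.ne_iff.1 hne
    refine Finset.sum_pos' (fun k _ => mul_nonneg (hP i k).le (hy k)) ⟨j, Finset.mem_univ _, ?_⟩
    exact mul_pos (hP i j) (lt_of_le_of_ne (hy j) (Ne.symm hj))
  have hxne : ∀ x ∈ stdSimplex ℝ V, x ≠ 0 := by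
    rintro x hx rfl
    have := hx.2
    simp at this
  let R : ℝ := ∑ i, ∑ j, B i j
  let K : Set ((V → ℝ) × ℝ) :=
    {z | z ∈ stdSimplex ℝ V ×ˢ Set.Icc 0 R ∧ ∀ i, z.2 * z.1 i ≤ (B *ᵥ z.1) i}
  have hcont : ∀ i, Continuous fun z : (V → ℝ) × ℝ => (B *ᵥ z.1) i := fun i =>
    (continuous_apply i).comp (continuous_const.matrix_mulVec continuous_fst)
  have hKc : IsCompact K := by
    have h1 : IsCompact (stdSimplex ℝ V ×ˢ Set.Icc 0 R) := (isCompact_stdSimplex ℝ V).prod isCompact_Icc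
    have h2 : IsClosed {z : (V → ℝ) × ℝ | ∀ i, z.2 * z.1 i ≤ (B *ᵥ z.1) i} := by
      simp only [Set.ofPred_forall]
      exact isClosed_iInter fun i => isClosed_le
        (continuous_snd.mul ((continuous_apply i).comp continuous_fst)) (hcont i)
    exact h1.inter_right h2
  have hBnn : ∀ x ∈ stdSimplex ℝ V, ∀ i, 0 ≤ (B *ᵥ x) i := fun x hx i =>
    Finset.sum_nonneg fun j _ => mul_nonneg (hB i j) (hx.1 j)
  have hR : 0 ≤ R := Finset.sum_nonneg fun i _ => Finset.sum_nonneg fun j _ => hB i j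
  have hKne : K.Nonempty := by
    obtain ⟨i₀⟩ := ‹Nonempty V›
    refine ⟨(Pi.single i₀ 1, 0), ⟨single_mem_stdSimplex ℝ i₀, le_refl _, hR⟩, fun i => ?_⟩
    rw [zero_mul]
    exact hBnn _ (single_mem_stdSimplex ℝ i₀) i
  obtain ⟨⟨x, r⟩, ⟨⟨hx, hr⟩, hle⟩, hmax⟩ := hKc.exists_isMaxOn hKne continuous_snd.continuousOn
  -- any admissible multiplier is at most the sum `R` of the entries
  have hbound : ∀ y ∈ stdSimplex ℝ V, ∀ s : ℝ, (∀ i, s * y i ≤ (B *ᵥ y) i) → s ≤ R := by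
    intro y hy s hs
    have h1 : ∑ i, s * y i ≤ ∑ i, (B *ᵥ y) i := Finset.sum_le_sum fun i _ => hs i
    rw [← Finset.mul_sum, hy.2, mul_one] at h1
    refine h1.trans (Finset.sum_le_sum fun i _ => Finset.sum_le_sum fun j _ => ?_)
    have : y j ≤ 1 := by
      rw [← hy.2]
      exact Finset.single_le_sum (fun k _ => hy.1 k) (Finset.mem_univ j)
    exact mul_le_of_le_one_right (hB i j) this
  have heq : B *ᵥ x = r • x := by
    by_contra hne
    have hpos := hPpos (B *ᵥ x - r • x) (fun i => by simpa using hle i) (sub_ne_zero.2 hne)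
    set z := P *ᵥ x with hz
    have hzpos : ∀ i, 0 < z i := hPpos x hx.1 (hxne x hx)
    have hstrict : ∀ i, r * z i < (B *ᵥ z) i := by
      intro i
      have := hpos i
      rw [Matrix.mulVec_sub, Matrix.mulVec_mulVec, hcomm, ← Matrix.mulVec_mulVec,
        Matrix.mulVec_smul] at this
      simpa only [Pi.sub_apply, Pi.smul_apply, smul_eq_mul, sub_pos] using this
    obtain ⟨i₀, -, hi₀⟩ := Finset.univ.exists_min_image (fun i => (B *ᵥ z) i / z i)
      Finset.univ_nonempty
    set s := (B *ᵥ z) i₀ / z i₀ with hs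
    have hrs : r < s := (lt_div_iff₀ (hzpos i₀)).2 (hstrict i₀)
    have hsz : ∀ i, s * z i ≤ (B *ᵥ z) i := fun i =>
      (le_div_iff₀ (hzpos i)).1 (hi₀ i (Finset.mem_univ i))
    set c := ∑ i, z i with hc
    have hcpos : 0 < c := Finset.sum_pos (fun i _ => hzpos i) Finset.univ_nonempty
    have hy : c⁻¹ • z ∈ stdSimplex ℝ V := by
      refine ⟨fun i => mul_nonneg (inv_nonneg.2 hcpos.le) (hzpos i).le, ?_⟩
      simp only [Pi.smul_apply, smul_eq_mul]
      rw [← Finset.mul_sum, inv_mul_cancel₀ hcpos.ne']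
    have hsy : ∀ i, s * (c⁻¹ • z) i ≤ (B *ᵥ (c⁻¹ • z)) i := by
      intro i
      rw [Matrix.mulVec_smul, Pi.smul_apply, Pi.smul_apply, smul_eq_mul, smul_eq_mul, mul_left_comm]
      exact mul_le_mul_of_nonneg_left (hsz i) (inv_nonneg.2 hcpos.le)
    have hmem : (c⁻¹ • z, s) ∈ K := ⟨⟨hy, (hr.1.trans hrs.le), hbound _ hy s hsy⟩, hsy⟩
    exact absurd (hmax hmem) (not_le.2 hrs)
  refine ⟨r, P *ᵥ x, hPpos x hx.1 (hxne x hx), ?_⟩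
  rw [Matrix.mulVec_mulVec, ← hcomm, ← Matrix.mulVec_mulVec, heq, Matrix.mulVec_smul]

/-- A nonnegative matrix that is positive along the links of a strongly connected network and on the
diagonal has a positive eigenvector, with positive eigenvalue. -/
theorem StronglyConnected.exists_perron {V : Type*} [Fintype V] [DecidableEq V] [Nonempty V]
    {N : V → Finset V} (h : StronglyConnected N) (B : Matrix V V ℝ) (hB : ∀ i j, 0 ≤ B i j)
    (hBpos : ∀ i j, j = i ∨ j ∈ N i → 0 < B i j) :
    ∃ (r : ℝ) (u : V → ℝ), 0 < r ∧ (∀ i, 0 < u i) ∧ B *ᵥ u = r • u := by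
  have hpow : ∀ n i j, 0 ≤ (B ^ n) i j := by
    intro n
    induction n with
    | zero =>
      intro i j
      rw [pow_zero, Matrix.one_apply]
      split_ifs <;> norm_num
    | succ n ih =>
      intro i j
      rw [pow_succ, Matrix.mul_apply]
      exact Finset.sum_nonneg fun k _ => mul_nonneg (ih i k) (hB k j)
  have hex : ∀ i j, ∃ n, 0 < (B ^ n) i j := by
    intro i j
    induction h i j with
    | refl => exact ⟨0, by simp⟩
    | @tail b c _ hbc ih =>
      obtain ⟨n, hn⟩ := ih
      refine ⟨n + 1, ?_⟩
      rw [pow_succ, Matrix.mul_apply]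
      exact Finset.sum_pos' (fun k _ => mul_nonneg (hpow n i k) (hB k c))
        ⟨b, Finset.mem_univ _, mul_pos hn (hBpos b c (Or.inr hbc))⟩
  choose n hn using hex
  let P : Matrix V V ℝ := ∑ e : V × V, B ^ n e.1 e.2
  have hP : ∀ i j, 0 < P i j := by
    intro i j
    simp only [P, Matrix.sum_apply]
    exact Finset.sum_pos' (fun e _ => hpow _ i j) ⟨(i, j), Finset.mem_univ _, hn i j⟩
  have hcomm : P * B = B * P := by
    simp only [P, Finset.sum_mul, Finset.mul_sum, ← pow_succ, ← pow_succ']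
  obtain ⟨r, u, hu, hru⟩ := exists_pos_eigenvector_of_commute B P hB hP hcomm
  refine ⟨r, u, ?_, hu, hru⟩
  obtain ⟨i⟩ := ‹Nonempty V›
  have h1 := congrFun hru i
  have h2 : 0 < (B *ᵥ u) i := Finset.sum_pos' (fun k _ => mul_nonneg (hB i k) (hu k).le)
    ⟨i, Finset.mem_univ _, mul_pos (hBpos i i (Or.inl rfl)) (hu i)⟩
  rw [h1, Pi.smul_apply, smul_eq_mul] at h2
  exact pos_of_mul_pos_left h2 (hu i).le

/-! ### Generic weights -/

section Generic

variable {V R : Type*} [Fintype V] [DecidableEq V] [Fintype R] [DecidableEq R]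

/-- Observability from a node is invariant under rescaling the coordinates of the nodes and
multiplication by a nonzero constant. -/
theorem ObservesFrom.of_scaling {B W : Matrix V V ℝ} {G : Matrix R R ℝ} {i : V} {z : R}
    (h : ObservesFrom B G i z) (r : ℝ) (u : V → ℝ) (hu : ∀ a, u a ≠ 0)
    (hW : ∀ a c, r * u a * W a c = B a c * u c) : ObservesFrom W G i z := by
  rw [observesFrom_iff] at h ⊢
  intro x hx
  let S : (V × R → ℝ) → V × R → ℝ := fun y s => u s.1 * y s
  have hstep : ∀ y, (B ⊗ₖ G) *ᵥ S y = r • S ((W ⊗ₖ G) *ᵥ y) := by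
    intro y
    funext ⟨a, k⟩
    simp only [S, Pi.smul_apply, smul_eq_mul, Matrix.mulVec, dotProduct, Matrix.kroneckerMap_apply,
      Finset.mul_sum]
    refine Finset.sum_congr rfl fun s _ => ?_
    linear_combination (-(G k s.2 * y s)) * hW a s.1
  have hpow : ∀ n, (B ⊗ₖ G) ^ n *ᵥ S x = r ^ n • S ((W ⊗ₖ G) ^ n *ᵥ x) := by
    intro n
    induction n with
    | zero => simp
    | succ n ih =>
      rw [pow_succ', ← Matrix.mulVec_mulVec, ih, Matrix.mulVec_smul, hstep, smul_smul, ← pow_succ,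
        Matrix.mulVec_mulVec, ← pow_succ']
  have hS : S x = 0 := h _ fun n => by
    rw [hpow]
    simp [S, hx n]
  funext s
  have := congrFun hS s
  exact (mul_eq_zero.1 this).resolve_left (hu s.1)

/-- Genericity of the observability of `B ⊗ₖ G` from one node, for `B` depending polynomially on
parameters. -/
theorem ae_observesFrom_of_exists {σ : Type*} [Fintype σ] (B : (σ → ℝ) → Matrix V V ℝ)
    (hB : ∀ i j, ∃ P : MvPolynomial σ ℝ, ∀ θ, B θ i j = MvPolynomial.eval θ P)
    (G : Matrix R R ℝ) (i : V) (z : R) (hex : ∃ θ, ObservesFrom (B θ) G i z) :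
    ∀ᵐ θ : σ → ℝ, ObservesFrom (B θ) G i z := by
  refine ae_isObservable_of_exists (fun θ => B θ ⊗ₖ G) _ ?_ ?_ hex
  · intro s s'
    obtain ⟨P, hP⟩ := hB s.1 s'.1
    exact ⟨P * MvPolynomial.C (G s.2 s'.2), fun θ => by simp [Matrix.kroneckerMap_apply, hP]⟩
  · exact fun _ s => ⟨MvPolynomial.C (Matrix.replicateRow Unit (Pi.single (i, z) 1) () s),
      fun θ => by simp⟩

/-- The weight matrix of a network with arbitrary loop weights and link weights. -/
def looseWeights (N : V → Finset V) (θ : {e : V × V // e.2 = e.1 ∨ e.2 ∈ N e.1} → ℝ) :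
    Matrix V V ℝ :=
  Matrix.of fun a c => if h : c = a ∨ c ∈ N a then θ ⟨(a, c), h⟩ else 0

/-- The weight matrix of a network with prescribed link weights whose rows sum to one: the loop weights
are determined by the link weights. -/
def affineWeights (N : V → Finset V) (w : {e : V × V // e.2 ∈ N e.1} → ℝ) : Matrix V V ℝ :=
  Matrix.of fun a c =>
    if c = a then 1 - ∑ b, (if h : b ∈ N a then w ⟨(a, b), h⟩ else 0)
    else if h : c ∈ N a then w ⟨(a, c), h⟩ else 0

theorem IsFusionMatrix.eq_affineWeights {N : V → Finset V} (hN : ∀ i, i ∉ N i) {W : Matrix V V ℝ}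
    (hW : IsFusionMatrix N W) (w : {e : V × V // e.2 ∈ N e.1} → ℝ)
    (hw : ∀ e, W e.1.1 e.1.2 = w e) : W = affineWeights N w := by
  have hoff : ∀ a b, b ≠ a → W a b = if h : b ∈ N a then w ⟨(a, b), h⟩ else 0 := by
    intro a b hb
    split_ifs with h
    · exact hw ⟨(a, b), h⟩
    · exact hW.eq_zero a b (by tauto)
  ext a c
  rw [affineWeights, Matrix.of_apply]
  split_ifs with h h'
  · subst h
    rw [← hW.row_sum c, eq_sub_iff_add_eq, ← Finset.add_sum_erase _ _ (Finset.mem_univ c),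
      ← Finset.add_sum_erase _ (fun b => W c b) (Finset.mem_univ c), dif_neg (hN c), zero_add]
    congr 1
    refine Finset.sum_congr rfl fun b hb => (hoff c b (Finset.ne_of_mem_erase hb)).symm
  · exact hw ⟨(a, c), h'⟩
  · exact hW.eq_zero a c (by tauto)

variable {r : ℕ}

/-- Some weights that are positive on all loops and links make `B ⊗ₖ G` observable from every node:
for a single node almost all weights do, because the weights of a spanning tree do. -/
theorem StronglyConnected.exists_pos_looseWeights {N : V → Finset V} (h : StronglyConnected N)
    (G : Matrix (Fin r) (Fin r) ℝ) (z : Fin r) (hz : (z : ℕ) = 0)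
    (hG1 : ∀ k, G k k = 1) (hG0 : ∀ k l, l < k → G k l = 0)
    (hGs : ∀ k l : Fin r, (l : ℕ) = k + 1 → G k l ≠ 0) :
    ∃ θ, (∀ e, 0 < θ e) ∧ ∀ i, ObservesFrom (looseWeights N θ) G i z := by
  have hae : ∀ᵐ θ, ∀ i, ObservesFrom (looseWeights N θ) G i z := by
    rw [ae_all_iff]
    intro i
    refine ae_observesFrom_of_exists (looseWeights N) ?_ G i z ?_
    · intro a c
      by_cases h : c = a ∨ c ∈ N a
      · exact ⟨MvPolynomial.X ⟨(a, c), h⟩, fun θ => by simp [looseWeights, h]⟩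
      · exact ⟨0, fun θ => by simp [looseWeights, h]⟩
    · obtain ⟨t, rfl, ht⟩ := h.exists_parentTree i
      let d : V → ℝ := fun a => (Fintype.equivFin V a : ℕ) + 1
      have hd : Function.Injective d := by
        intro a b hab
        have : ((Fintype.equivFin V a : ℕ) : ℝ) = (Fintype.equivFin V b : ℕ) := by
          simpa [d] using hab
        exact (Fintype.equivFin V).injective (Fin.ext (by exact_mod_cast this))
      have hd0 : ∀ a, d a ≠ 0 := fun a => by positivity
      refine ⟨fun e => t.matrix d e.1.1 e.1.2, ?_⟩
      have : looseWeights N (fun e => t.matrix d e.1.1 e.1.2) = t.matrix d := by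
        ext a c
        rw [looseWeights, Matrix.of_apply]
        split_ifs with hac
        · rfl
        · push Not at hac
          rw [ParentTree.matrix, Matrix.add_apply, Matrix.diagonal_apply_ne' _ hac.1, Matrix.of_apply,
            if_neg, add_zero]
          rintro ⟨hc, rfl⟩
          exact hac.2 (ht c hc)
      rw [this]
      exact t.observesFrom G z hz hG1 hG0 hGs d hd hd0
  have hopen : IsOpen {θ : {e : V × V // e.2 = e.1 ∨ e.2 ∈ N e.1} → ℝ | ∀ e, 0 < θ e} := by
    simp only [Set.ofPred_forall]
    exact isOpen_iInter_of_finite fun e => isOpen_lt continuous_const (continuous_apply e)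
  obtain ⟨θ, hθ, hθ'⟩ := (Measure.dense_of_ae hae).inter_open_nonempty _ hopen
    ⟨fun _ => 1, fun _ => one_pos⟩
  exact ⟨θ, hθ, hθ'⟩

/-- For almost all link weights, the row-stochastic weights they determine make `W ⊗ₖ G` observable from
every node. One good choice is obtained from positive unconstrained weights by rescaling the nodes by
their Perron vector, which makes all row sums one. -/
theorem StronglyConnected.ae_affineWeights {N : V → Finset V} (hN : ∀ i, i ∉ N i)
    (h : StronglyConnected N)
    (G : Matrix (Fin r) (Fin r) ℝ) (z : Fin r) (hz : (z : ℕ) = 0)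
    (hG1 : ∀ k, G k k = 1) (hG0 : ∀ k l, l < k → G k l = 0)
    (hGs : ∀ k l : Fin r, (l : ℕ) = k + 1 → G k l ≠ 0) :
    ∀ᵐ w : {e : V × V // e.2 ∈ N e.1} → ℝ, ∀ i, ObservesFrom (affineWeights N w) G i z := by
  rw [ae_all_iff]
  intro i
  refine ae_observesFrom_of_exists (affineWeights N) ?_ G i z ?_
  · have hlink : ∀ a c, ∃ P : MvPolynomial {e : V × V // e.2 ∈ N e.1} ℝ, ∀ w,
        (if h : c ∈ N a then w ⟨(a, c), h⟩ else 0) = MvPolynomial.eval w P := by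
      intro a c
      by_cases hc : c ∈ N a
      · exact ⟨MvPolynomial.X ⟨(a, c), hc⟩, fun w => by simp [hc]⟩
      · exact ⟨0, fun w => by simp [hc]⟩
    choose P hP using hlink
    intro a c
    by_cases hca : c = a
    · exact ⟨1 - ∑ b, P a b, fun w => by simp [affineWeights, hca, hP]⟩
    · exact ⟨P a c, fun w => by simp [affineWeights, hca, ← hP]⟩
  · obtain ⟨θ, hθ, hobs⟩ := h.exists_pos_looseWeights G z hz hG1 hG0 hGs
    have : Nonempty V := ⟨i⟩
    set B := looseWeights N θ with hB
    have hBpos : ∀ a c, c = a ∨ c ∈ N a → 0 < B a c := by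
      intro a c hac
      rw [hB, looseWeights, Matrix.of_apply, dif_pos hac]
      exact hθ _
    have hB0 : ∀ a c, ¬(c = a ∨ c ∈ N a) → B a c = 0 := by
      intro a c hac
      rw [hB, looseWeights, Matrix.of_apply, dif_neg hac]
    have hBnn : ∀ a c, 0 ≤ B a c := by
      intro a c
      by_cases hac : c = a ∨ c ∈ N a
      · exact (hBpos a c hac).le
      · exact (hB0 a c hac).ge
    obtain ⟨ρ, u, hρ, hu, hBu⟩ := h.exists_perron B hBnn hBpos
    refine ⟨fun e => B e.1.1 e.1.2 * u e.1.2 / (ρ * u e.1.1), ?_⟩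
    refine (hobs i).of_scaling ρ u (fun a => (hu a).ne') fun a c => ?_
    have hden : ρ * u a ≠ 0 := (mul_pos hρ (hu a)).ne'
    rw [affineWeights, Matrix.of_apply]
    split_ifs with hca hc
    · subst hca
      have h1 : ∀ b, b ≠ c → (ρ * u c) * (if h : b ∈ N c then B c b * u b / (ρ * u c) else 0)
          = B c b * u b := by
        intro b hb
        split_ifs with hbN
        · rw [mul_div_assoc', mul_div_cancel_left₀ _ hden]
        · rw [hB0 c b (by tauto), mul_zero, zero_mul]
      have h2 : ∑ b, B c b * u b = ρ * u c := congrFun hBu c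
      rw [mul_sub, mul_one, Finset.mul_sum, ← Finset.add_sum_erase _ _ (Finset.mem_univ c),
        dif_neg (hN c), mul_zero, zero_add,
        Finset.sum_congr rfl fun b hb => h1 b (Finset.ne_of_mem_erase hb), ← h2,
        ← Finset.add_sum_erase _ (fun b => B c b * u b) (Finset.mem_univ c), add_sub_cancel_right]
    · rw [mul_div_assoc', mul_div_cancel_left₀ _ hden]
    · rw [hB0 a c (by tauto), mul_zero, zero_mul]

end Generic

/-! ### The target models -/

/-- The transition matrix of a target model in a single coordinate direction. -/
noncomputable def TargetModel.coordTransition :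
    (M : TargetModel) → ℝ → Matrix (Fin M.order) (Fin M.order) ℝ
  | .ncv, T => !![1, T; 0, 1]
  | .nca, T => !![1, T, T ^ 2 / 2; 0, 1, T; 0, 0, 1]

/-- The index of the position among the derivatives in the state. -/
def TargetModel.position (M : TargetModel) : Fin M.order := ⟨0, by cases M <;> decide⟩

namespace TargetModel

theorem transition_eq (M : TargetModel) (T : ℝ) :
    M.transition T = M.coordTransition T ⊗ₖ (1 : Matrix (Fin 3) (Fin 3) ℝ) := by
  cases M <;> rfl

theorem coordTransition_diag (M : TargetModel) (T : ℝ) (k) : M.coordTransition T k k = 1 := by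
  cases M <;> simp only [order] at k <;> fin_cases k <;> simp [coordTransition]

theorem coordTransition_lower (M : TargetModel) (T : ℝ) (k l) (h : l < k) :
    M.coordTransition T k l = 0 := by
  cases M <;> simp only [order] at k l <;> fin_cases k <;> fin_cases l <;>
    first | (exfalso; revert h; decide) | simp [coordTransition]

theorem coordTransition_super (M : TargetModel) {T : ℝ} (hT : 0 < T) (k l : Fin M.order)
    (h : (l : ℕ) = k + 1) : M.coordTransition T k l ≠ 0 := by
  cases M <;> simp only [order] at k l <;> fin_cases k <;> fin_cases l <;>
    first | (exfalso; revert h; decide) | simpa [coordTransition] using hT.ne'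

end TargetModel

/-- The contraction of the coordinate index of a state with a fixed vector. -/
def contract {V R D : Type*} [Fintype D] (q : D → ℝ) (x : V × (R × D) → ℝ) : V × R → ℝ :=
  fun s => ∑ c, x (s.1, (s.2, c)) * q c

theorem contract_mulVec {V R D : Type*} [Fintype V] [Fintype R] [Fintype D] [DecidableEq D]
    (B : Matrix V V ℝ) (G : Matrix R R ℝ) (q : D → ℝ) (x : V × (R × D) → ℝ) :
    contract q ((B ⊗ₖ (G ⊗ₖ (1 : Matrix D D ℝ))) *ᵥ x) = (B ⊗ₖ G) *ᵥ contract q x := by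
  have h : ∀ (s : V × R) (c : D), ((B ⊗ₖ (G ⊗ₖ (1 : Matrix D D ℝ))) *ᵥ x) (s.1, (s.2, c))
      = ∑ t : V × R, B s.1 t.1 * G s.2 t.2 * x (t.1, (t.2, c)) := by
    intro s c
    simp only [Matrix.mulVec, dotProduct, Matrix.kroneckerMap_apply, Fintype.sum_prod_type,
      Matrix.one_apply]
    simp [mul_assoc]
  funext s
  simp only [contract, h, Finset.sum_mul]
  rw [Finset.sum_comm]
  simp only [Matrix.mulVec, dotProduct, Matrix.kroneckerMap_apply, mul_assoc, ← Finset.mul_sum]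
  rfl

theorem contract_pow_mulVec {V R D : Type*} [Fintype V] [DecidableEq V] [Fintype R] [DecidableEq R]
    [Fintype D] [DecidableEq D] (B : Matrix V V ℝ) (G : Matrix R R ℝ) (q : D → ℝ)
    (x : V × (R × D) → ℝ) (n : ℕ) :
    contract q ((B ⊗ₖ (G ⊗ₖ (1 : Matrix D D ℝ))) ^ n *ᵥ x) = (B ⊗ₖ G) ^ n *ᵥ contract q x := by
  induction n with
  | zero => simp
  | succ n ih =>
    rw [pow_succ', ← Matrix.mulVec_mulVec, contract_mulVec, ih, Matrix.mulVec_mulVec, ← pow_succ']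

/-! ### The outputs -/

theorem StronglyConnected.eq_of_forall_link {V : Type*} {N : V → Finset V} {α : Type*}
    (h : StronglyConnected N) (f : V → α)
    (hf : ∀ i, ∀ j ∈ N i, f j = f i) (i j : V) : f j = f i := by
  induction h i j with
  | refl => rfl
  | tail _ hbc ih => exact (hf _ _ hbc).trans ih

/-- A linear functional that is constant on a set of points spanning the whole space vanishes. -/
theorem eq_zero_of_affineSpan_eq_top {V : Type*} {p : V → EuclideanSpace ℝ (Fin 3)}
    (hp : affineSpan ℝ (Set.range p) = ⊤) (ξ : Fin 3 → ℝ)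
    (h : ∀ i j, ∑ c, ξ c * p j c = ∑ c, ξ c * p i c) : ξ = 0 := by
  let φ : EuclideanSpace ℝ (Fin 3) →ₗ[ℝ] ℝ :=
    { toFun := fun v => ∑ c, ξ c * v c
      map_add' := fun v w => by simp [mul_add, Finset.sum_add_distrib]
      map_smul' := fun a v => by simp [Finset.mul_sum, mul_left_comm] }
  have hspan : vectorSpan ℝ (Set.range p) = ⊤ :=
    AffineSubspace.vectorSpan_eq_top_of_affineSpan_eq_top ℝ _ _ hp
  have hle : vectorSpan ℝ (Set.range p) ≤ LinearMap.ker φ := by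
    rw [vectorSpan_def, Submodule.span_le]
    rintro _ ⟨_, ⟨j, rfl⟩, _, ⟨i, rfl⟩, rfl⟩
    change φ (p j -ᵥ p i) = 0
    rw [vsub_eq_sub, map_sub, sub_eq_zero]
    exact h i j
  funext c
  have : EuclideanSpace.single c (1 : ℝ) ∈ LinearMap.ker φ := hle (hspan ▸ Submodule.mem_top)
  simpa [φ] using LinearMap.mem_ker.1 this

theorem outputGram_apply {V : Type*} [DecidableEq V] (N : V → Finset V)
    (p : V → EuclideanSpace ℝ (Fin 3)) (M : TargetModel) (i j : V) (s t : M.State) :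
    outputGram N p M (i, s) (j, t)
      = if i = j then ((outputMatrix N p M i)ᵀ * outputMatrix N p M i) s t else 0 := by
  simp [outputGram, Matrix.blockDiagonal_apply]

theorem outputGram_diag_ne_zero {V : Type*} [DecidableEq V] (N : V → Finset V)
    (p : V → EuclideanSpace ℝ (Fin 3)) (M : TargetModel)
    {i j : V} (hij : j ∈ N i) {c : Fin 3} (hc : p j c ≠ p i c) :
    outputGram N p M (i, (M.position, c)) (i, (M.position, c)) ≠ 0 := by
  rw [outputGram_apply, if_pos rfl, Matrix.mul_apply]
  refine (Finset.sum_pos' (fun k _ => mul_self_nonneg _) ⟨⟨j, hij⟩, Finset.mem_univ _, ?_⟩).ne'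
  refine mul_self_pos.2 ?_
  simpa [outputMatrix, TargetModel.position] using sub_ne_zero.2 hc

section Output

variable {V : Type*} [Fintype V] [DecidableEq V] (N : V → Finset V)
  (p : V → EuclideanSpace ℝ (Fin 3)) (M : TargetModel)

/-- A state that the Gram matrices of the outputs annihilate has vanishing output at every link. -/
theorem contract_eq_zero_of_outputGram_mulVec {y : V × M.State → ℝ}
    (h : outputGram N p M *ᵥ y = 0) {i j : V} (hij : j ∈ N i) :
    contract (fun c => p j c - p i c) y (i, M.position) = 0 := by
  set H := outputMatrix N p M i with hH
  have h1 : (Hᵀ * H) *ᵥ (fun s => y (i, s)) = 0 := by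
    funext s
    have := congrFun h (i, s)
    simpa [Matrix.mulVec, dotProduct, Fintype.sum_prod_type (α₁ := V), outputGram_apply, ← hH,
      ite_mul] using this
  have h2 : H *ᵥ (fun s => y (i, s)) = 0 := by
    have := SetLike.ext_iff.1 (Matrix.ker_mulVecLin_transpose_mul_self H) fun s => y (i, s)
    simp only [LinearMap.mem_ker, Matrix.mulVecLin_apply] at this
    exact this.1 h1
  have h3 := congrFun h2 ⟨j, hij⟩
  rw [Matrix.mulVec, dotProduct, Fintype.sum_prod_type, Finset.sum_eq_single M.position] at h3
  · refine (Finset.sum_congr rfl fun c _ => ?_).trans h3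
    simp [hH, outputMatrix, TargetModel.position, mul_comm]
  · intro k _ hk
    have : (k : ℕ) ≠ 0 := fun h0 => hk (Fin.ext h0)
    simp [hH, outputMatrix, this]
  · simp

variable {N p M}

/-- If the weights make the single-coordinate dynamics observable from every node and the sensors span
the space, the TDOA outputs determine the state: every link reveals the component of the state along the
direction of the link, and these directions span the space. -/
theorem isObservable_outputGram (hconn : StronglyConnected N)
    (hp : affineSpan ℝ (Set.range p) = ⊤) (T : ℝ) {W : Matrix V V ℝ}
    (hW : ∀ i, ObservesFrom W (M.coordTransition T) i M.position) :
    IsObservable (W ⊗ₖ M.transition T) (outputGram N p M) := by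
  rw [isObservable_iff, M.transition_eq]
  intro x hx
  have hlink : ∀ i, ∀ j ∈ N i, contract (fun c => p j c - p i c) x = 0 := by
    intro i j hij
    refine (observesFrom_iff _ _ _ _).1 (hW i) _ fun n => ?_
    rw [← contract_pow_mulVec]
    exact contract_eq_zero_of_outputGram_mulVec N p M (hx n) hij
  have hzero : ∀ a k, (fun c => x (a, (k, c))) = 0 := by
    intro a k
    refine eq_zero_of_affineSpan_eq_top hp _ fun i j => ?_
    refine hconn.eq_of_forall_link (fun j => ∑ c, x (a, (k, c)) * p j c) (fun i j hij => ?_) i j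
    have := congrFun (hlink i j hij) (a, k)
    simpa [contract, mul_sub, Finset.sum_sub_distrib, sub_eq_zero] using this
  funext ⟨a, k, c⟩
  exact congrFun (hzero a k) c

/-- If the weights make the single-coordinate dynamics observable from every node, then it suffices to
measure each coordinate of the position at one node. -/
theorem isObservable_of_diagonal (T : ℝ) {W : Matrix V V ℝ}
    (hW : ∀ i, ObservesFrom W (M.coordTransition T) i M.position)
    (C : Matrix (V × M.State) (V × M.State) ℝ)
    (hC : ∀ s t, s ≠ t → C s t = 0) (i : Fin 3 → V)
    (hCi : ∀ c, C (i c, (M.position, c)) (i c, (M.position, c)) ≠ 0) :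
    IsObservable (W ⊗ₖ M.transition T) C := by
  rw [isObservable_iff, M.transition_eq]
  intro x hx
  have hcoord : ∀ c, contract (Pi.single c 1) x = 0 := by
    intro c
    refine (observesFrom_iff _ _ _ _).1 (hW (i c)) _ fun n => ?_
    rw [← contract_pow_mulVec]
    have := congrFun (hx n) (i c, (M.position, c))
    rw [Matrix.mulVec, dotProduct, Finset.sum_eq_single (i c, (M.position, c))] at this
    · simpa [contract, Pi.single_apply] using (mul_eq_zero.1 this).resolve_left (hCi c)
    · intro t _ ht
      rw [hC _ _ ht.symm, zero_mul]
    · simp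
  funext ⟨a, k, c⟩
  simpa [contract, Pi.single_apply] using congrFun (hcoord c) (a, k)

end Output

/-! ### Structural observability -/

theorem reassign_eq {κ ι : Type*} {A A' : Matrix κ ι ℝ} (h : ∀ i j, A i j = 0 → A' i j = 0) :
    reassign A (fun q => A' q.1.1 q.1.2) = A' := by
  ext i j
  rw [reassign, Matrix.of_apply]
  split_ifs with hij
  · rfl
  · exact (h i j (not_not.1 hij)).symm

/-- One observable pair with at most the nonzero entries of `(A, C)` makes `(A, C)` generically
observable. -/
theorem isGenericallyObservable_of_exists {ι κ : Type*} [Fintype ι] [DecidableEq ι] [Fintype κ]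
    {A A' : Matrix ι ι ℝ} {C C' : Matrix κ ι ℝ} (hA : ∀ i j, A i j = 0 → A' i j = 0)
    (hC : ∀ i j, C i j = 0 → C' i j = 0) (h : IsObservable A' C') :
    IsGenericallyObservable A C := by
  refine ae_isObservable_of_exists
    (fun θ : (NonzeroPos A ⊕ NonzeroPos C) → ℝ => reassign A fun q => θ (Sum.inl q))
    (fun θ => reassign C fun q => θ (Sum.inr q)) ?_ ?_ ?_
  · intro i j
    by_cases hij : A i j ≠ 0
    · exact ⟨MvPolynomial.X (Sum.inl ⟨(i, j), hij⟩), fun θ => by simp [reassign, hij]⟩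
    · exact ⟨0, fun θ => by simp [reassign, not_not.1 hij]⟩
  · intro i j
    by_cases hij : C i j ≠ 0
    · exact ⟨MvPolynomial.X (Sum.inr ⟨(i, j), hij⟩), fun θ => by simp [reassign, hij]⟩
    · exact ⟨0, fun θ => by simp [reassign, not_not.1 hij]⟩
  · refine ⟨Sum.elim (fun q => A' q.1.1 q.1.2) (fun q => C' q.1.1 q.1.2), ?_⟩
    simp only [Sum.elim_inl, Sum.elim_inr]
    rwa [reassign_eq hA, reassign_eq hC]

theorem mainTheorem1 {V : Type*} [Fintype V] [DecidableEq V]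
    (N : V → Finset V) (hN : ∀ i, i ∉ N i) (hconn : StronglyConnected N)
    (p : V → EuclideanSpace ℝ (Fin 3)) (hp : ∀ c : Fin 3, ∃ i j, p i c ≠ p j c)
    (M : TargetModel) (T : ℝ) (hT : 0 < T) :
    (∀ W : Matrix V V ℝ, IsFusionMatrix N W →
      IsGenericallyObservable (W ⊗ₖ M.transition T) (outputGram N p M)) ∧
    (affineSpan ℝ (Set.range p) = ⊤ →
      ∀ᵐ w : {e : V × V // e.2 ∈ N e.1} → ℝ, ∀ W : Matrix V V ℝ,
        IsFusionMatrix N W → (∀ e, W e.1.1 e.1.2 = w e) →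
          IsObservable (W ⊗ₖ M.transition T) (outputGram N p M)) := by
  have hae := hconn.ae_affineWeights hN (M.coordTransition T) M.position rfl
    (M.coordTransition_diag T) (M.coordTransition_lower T) (M.coordTransition_super hT)
  refine ⟨fun W hW => ?_, fun hspan => ?_⟩
  · obtain ⟨w, hw⟩ := hae.exists
    -- in each coordinate, some link joins two sensors with different positions
    have hex : ∀ c : Fin 3, ∃ i, ∃ j ∈ N i, p j c ≠ p i c := by
      intro c
      by_contra! h
      obtain ⟨i, j, hij⟩ := hp c
      exact hij (hconn.eq_of_forall_link (fun k => p k c) h j i)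
    choose i j hj hij using hex
    refine isGenericallyObservable_of_exists (A' := affineWeights N w ⊗ₖ M.transition T)
      (C' := Matrix.diagonal fun s => outputGram N p M s s) ?_ ?_
      (isObservable_of_diagonal T hw _ (fun s t hst => Matrix.diagonal_apply_ne _ hst) i fun c => ?_)
    · rintro ⟨a, s⟩ ⟨b, t⟩ h
      rw [Matrix.kroneckerMap_apply] at h ⊢
      rcases mul_eq_zero.1 h with h | h
      · have hab : ¬(b = a ∨ b ∈ N a) := fun hab => (hW.mem_Ioo a b hab).1.ne' h
        push Not at hab
        simp [affineWeights, hab.1, hab.2]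
      · rw [h, mul_zero]
    · intro s t h
      rw [Matrix.diagonal_apply]
      split_ifs with hst
      · subst hst
        exact h
      · rfl
    · rw [Matrix.diagonal_apply_eq]
      exact outputGram_diag_ne_zero N p M (hj c) (hij c)
  · filter_upwards [hae] with w hw W hW hWw
    rw [hW.eq_affineWeights hN w hWw]
    exact isObservable_outputGram hconn hspan T hw
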